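/- Let $S$ be a finite set of points in $\mathbb{R}^3$ and let $D$ be its diameter. The diameter graph $G$ of $S$ has vertex set $S$, and two distinct points of $S$ are adjacent when their distance is $D$. Then $G$ can be embedded in the projective plane $\mathbb{RP}^2=\mathbb{S}^2/\{\pm1\}$ (vertices are distinct points, edges are simple arcs joining their end vertices, an arc contains no vertices other than its ends, and arcs of different edges meet at most in common end vertices) in such a way that every odd cycle of $G$ forms a noncontractible (not null-homotopic) closed curve. Moreover, the embedding can be chosen as the image, under the identification of antipodal points, of a centrally symmetric crossing-free drawing on $\mathbb{S}^2$ of the bipartite double cover of $G$. Here the bipartite double cover has two vertices $x_r,x_b$ for each $x\in S$ and two edges $x_ry_b$, $x_by_r$ for each edge $xy$ of $G$, and a drawing is centrally symmetric when $x_b=-x_r$ for all $x\in S$ and the arcs drawn for $x_ry_b$ and $x_by_r$ are antipodal for every edge $xy$. -/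

import Mathlib

open scoped unitInterval

/-- The diameter graph of a set `S` in a metric space: distinct points of `S` are joined when their
distance is the diameter of `S`. It is used for finite `S`, where `Metric.diam S` is the
largest distance between two points of `S`. -/
def diameterGraph {X : Type*} [MetricSpace X] (S : Set X) : SimpleGraph S where
  Adj x y := x ≠ y ∧ dist (x : X) (y : X) = Metric.diam S
  symm := ⟨fun _ _ h => ⟨h.1.symm, by rw [dist_comm]; exact h.2⟩⟩
  loopless := ⟨fun _ h => h.1 rfl⟩

/-- A drawing without crossings (an embedding) of a graph `G` in a topological space `X`:
vertices are distinct points, every edge is a simple arc joining its end vertices, an arc contains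
no vertices except its two ends, and arcs of different edges meet at most in common ends.
The arc of an edge run in the other direction is the reversed path. -/
structure GraphEmbedding {V : Type*} (G : SimpleGraph V) (X : Type*) [TopologicalSpace X] where
  vertex : V → X
  arc : ∀ {u v : V}, G.Adj u v → Path (vertex u) (vertex v)
  vertex_injective : Function.Injective vertex
  arc_injective : ∀ {u v : V} (h : G.Adj u v), Function.Injective (arc h)
  arc_symm : ∀ {u v : V} (h : G.Adj u v), arc h.symm = (arc h).symm
  arc_avoids_vertex : ∀ {u v : V} (h : G.Adj u v) (w : V) (t : I),
    arc h t = vertex w → t = 0 ∨ t = 1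
  arc_disjoint : ∀ {u v u' v' : V} (h : G.Adj u v) (h' : G.Adj u' v') (s t : I),
    s(u, v) ≠ s(u', v') → arc h s = arc h' t → (s = 0 ∨ s = 1) ∧ (t = 0 ∨ t = 1)

/-- The path in `X` traced by a walk of an embedded graph: the arcs of its successive edges are
concatenated. For a cycle this is the closed curve formed by the cycle. -/
noncomputable def GraphEmbedding.walkPath {V : Type*} {G : SimpleGraph V} {X : Type*}
    [TopologicalSpace X] (E : GraphEmbedding G X) :
    ∀ {u v : V}, G.Walk u v → Path (E.vertex u) (E.vertex v)
  | _, _, .nil => Path.refl _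
  | _, _, .cons h p => (E.arc h).trans (E.walkPath p)

/-- A closed curve is contractible when it is null-homotopic. -/
def Path.IsContractible {X : Type*} [TopologicalSpace X] {x : X} (γ : Path x x) : Prop :=
  γ.Homotopic (Path.refl x)

/-- The unit sphere in Euclidean `3`-space, centred at the origin. -/
abbrev UnitSphere : Type := Metric.sphere (0 : EuclideanSpace ℝ (Fin 3)) 1

/-- Identification of antipodal points of the sphere. -/
def antipodalSetoid : Setoid UnitSphere where
  r x y := x = y ∨ x = -y
  iseqv :=
    { refl := fun _ => Or.inl rfl
      symm := by
        rintro x y (h | h)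
        · exact Or.inl h.symm
        · exact Or.inr (by rw [h, neg_neg])
      trans := by
        rintro x y z (rfl | rfl) (rfl | rfl)
        · exact Or.inl rfl
        · exact Or.inr rfl
        · exact Or.inr rfl
        · exact Or.inl (neg_neg _) }

/-- The projective plane, the sphere with antipodal points identified. -/
abbrev ProjectivePlane : Type := Quotient antipodalSetoid

/-- The quotient map from the sphere to the projective plane. -/
def toProjectivePlane : UnitSphere → ProjectivePlane := Quotient.mk antipodalSetoid

theorem bipartiteDoubleCover_adj_swap {V : Type*} {G : SimpleGraph V} {w w' : V ⊕ V}
    (h : G.bipartiteDoubleCover.Adj w w') : G.bipartiteDoubleCover.Adj w.swap w'.swap := by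
  cases w <;> cases w' <;> simpa using h

theorem bipartiteDoubleCover_adj_inl_inr {V : Type*} {G : SimpleGraph V} {u v : V}
    (h : G.Adj u v) : G.bipartiteDoubleCover.Adj (Sum.inl u) (Sum.inr v) := by
  simpa using h

/-- A drawing on the sphere of the bipartite double cover of `G` is centrally symmetric when the two
copies `x_r = Sum.inl x` and `x_b = Sum.inr x` of a vertex are antipodal points, and the arcs
of the edges `x_r y_b` and `x_b y_r` are antipodal. -/
def GraphEmbedding.IsCentrallySymmetric {V : Type*} {G : SimpleGraph V}
    (D : GraphEmbedding G.bipartiteDoubleCover UnitSphere) : Prop :=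
  (∀ w, D.vertex w.swap = -D.vertex w) ∧
  ∀ (w w' : V ⊕ V) (h : G.bipartiteDoubleCover.Adj w w') (t : I),
    D.arc (bipartiteDoubleCover_adj_swap h) t = -D.arc h t

/-- The embedding `E` of `G` in the projective plane is the image of the drawing `D` of the
double cover under identification of antipodal points. (When `D` is centrally symmetric, the other
copies of the vertices and edges have the same image.) -/
def GraphEmbedding.IsAntipodalQuotient {V : Type*} {G : SimpleGraph V}
    (E : GraphEmbedding G ProjectivePlane)
    (D : GraphEmbedding G.bipartiteDoubleCover UnitSphere) : Prop :=
  (∀ v, E.vertex v = toProjectivePlane (D.vertex (Sum.inl v))) ∧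
  ∀ (u v : V) (h : G.Adj u v) (t : I),
    E.arc h t = toProjectivePlane (D.arc (bipartiteDoubleCover_adj_inl_inr h) t)

/-! Suppose first that every point has at least two neighbours. At each `x` take the cone of the
vectors `y - x` over the neighbours `y`, and in it the star of segments from the hub `c x`, the sum
of these vectors, to the tips `y - x`. Project all stars and their antipodes radially to the sphere.
The tip of `x` towards `y` is antipodal to that of `y` towards `x`, so the star of `x` and the
negated star of `y` join to an arc for `x_r y_b`.

No crossings occur, for three reasons. Vectors in the cone at `x` have positive inner product with
`z - x` for all other `z` in `S`, so cones at different points share no ray. If `p` of length `D`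
lies in the cone at `x` and `-p` in the cone at `y`, a ball-intersection argument forces `p = y - x`
(`eq_sub_of_coneCombination_eq_neg`). Finally `y - x` spans an extreme ray of the cone
(`eq_zero_of_coneCombination_eq`), so stars meet antipodes only in tips. This gives
`isStarSystem_distanceGraph`.

A point with at most one neighbour is removed by induction and put back along a short generic
segment (`IsStarSystem.exists_insert`).

The drawing descends to the projective plane. Lifting an arc of `G` switches between red and blue
vertices, so an odd closed walk lifts to a path between antipodal points and cannot be
null-homotopic. -/

theorem bipartiteDoubleCover_adj_inr_inl {V : Type*} {G : SimpleGraph V} {u v : V}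
    (h : G.Adj u v) : G.bipartiteDoubleCover.Adj (Sum.inr u) (Sum.inl v) := by
  simpa using h

/-! ### The antipodal quotient as a two-sheeted covering. -/

theorem toProjectivePlane_eq_iff {x y : UnitSphere} :
    toProjectivePlane x = toProjectivePlane y ↔ x = y ∨ x = -y :=
  Quotient.eq (r := antipodalSetoid)

theorem toProjectivePlane_neg (x : UnitSphere) : toProjectivePlane (-x) = toProjectivePlane x :=
  toProjectivePlane_eq_iff.2 (Or.inr rfl)

theorem isQuotientMap_toProjectivePlane : Topology.IsQuotientMap toProjectivePlane :=
  isQuotientMap_quotient_mk'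

theorem UnitSphere.ne_neg_self (x : UnitSphere) : x ≠ -x := by
  intro h
  have h1 : (x : EuclideanSpace ℝ (Fin 3)) = -x := congrArg Subtype.val h
  have h2 : (x : EuclideanSpace ℝ (Fin 3)) = 0 := by
    rw [eq_neg_iff_add_eq_zero, ← two_smul ℝ] at h1
    simpa using h1
  have := x.2
  rw [h2] at this
  simp at this

/-- The action of the two units of `ℤ` on the sphere by signs. -/
@[reducible] noncomputable def signAction : MulAction ℤˣ UnitSphere where
  smul u x := if u = 1 then x else -x
  one_smul x := if_pos rfl
  mul_smul u v x := by
    change (if u * v = 1 then x else -x) = if u = 1 then (if v = 1 then x else -x) else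
      -(if v = 1 then x else -x)
    rcases Int.units_eq_one_or u with rfl | rfl <;> rcases Int.units_eq_one_or v with rfl | rfl <;>
      simp

theorem isCoveringMap_toProjectivePlane : IsCoveringMap toProjectivePlane := by
  let := signAction
  have smul_def : ∀ (u : ℤˣ) (x : UnitSphere), u • x = if u = 1 then x else -x := fun _ _ => rfl
  refine IsQuotientCoveringMap.isCoveringMap _ ℤˣ (show IsQuotientCoveringMap _ ℤˣ from
    { toIsQuotientMap := isQuotientMap_toProjectivePlane
      continuous_const_smul := fun u => ?_
      apply_eq_iff_mem_orbit := fun {x y} => ?_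
      disjoint := fun e => ?_ })
  · rcases Int.units_eq_one_or u with rfl | rfl
    · simpa [smul_def] using continuous_id'
    · simpa [smul_def] using continuous_neg
  · rw [toProjectivePlane_eq_iff, MulAction.mem_orbit_iff]
    constructor
    · rintro (h | h)
      · exact ⟨1, by simp [smul_def, h]⟩
      · exact ⟨-1, by simp [smul_def, h]⟩
    · rintro ⟨u, rfl⟩
      rcases Int.units_eq_one_or u with rfl | rfl <;> simp [smul_def]
  -- Radius 1 suffices: `y` and `-y` have distance 2, so they cannot both lie in an open unit ball.
  · refine ⟨Metric.ball e 1, Metric.ball_mem_nhds e one_pos, fun u hu => ?_⟩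
    rcases Int.units_eq_one_or u with rfl | rfl
    · rfl
    · obtain ⟨_, ⟨y, hy, rfl⟩, hy'⟩ := hu
      exfalso
      have h1 : dist y e < 1 := hy
      have h2 : dist (-y) e < 1 := by simpa [smul_def] using hy'
      have h3 : dist y (-y) < 2 := by linarith [dist_triangle_right y (-y) e]
      have h4 : ‖(y : EuclideanSpace ℝ (Fin 3))‖ = 1 := by simp
      rw [Subtype.dist_eq, dist_eq_norm] at h3
      have h5 : (y : EuclideanSpace ℝ (Fin 3)) - ((-y : UnitSphere) : EuclideanSpace ℝ (Fin 3))
          = (2 : ℝ) • y.1 := by rw [two_smul]; simp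
      rw [h5, norm_smul, h4] at h3
      norm_num at h3

/-! ### Descent of a symmetric drawing, and parity of lifted walks. -/

namespace GraphEmbedding

variable {V : Type*} {G : SimpleGraph V}

section AntipodalQuotient

variable (D : GraphEmbedding G.bipartiteDoubleCover UnitSphere) (hD : D.IsCentrallySymmetric)
include hD

theorem IsCentrallySymmetric.vertex_inr (v : V) :
    D.vertex (Sum.inr v) = -D.vertex (Sum.inl v) := hD.1 (Sum.inl v)

theorem IsCentrallySymmetric.arc_inr_inl {u v : V} (h : G.Adj u v) (t : I) :
    D.arc (bipartiteDoubleCover_adj_inr_inl h) t = -D.arc (bipartiteDoubleCover_adj_inl_inr h) t :=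
  hD.2 _ _ (bipartiteDoubleCover_adj_inl_inr h) t

/-- The image of a centrally symmetric drawing under identification of antipodal points. -/
noncomputable def antipodalQuotient : GraphEmbedding G ProjectivePlane where
  vertex v := toProjectivePlane (D.vertex (Sum.inl v))
  arc {u v} h :=
    { toFun := fun t => toProjectivePlane (D.arc (bipartiteDoubleCover_adj_inl_inr h) t)
      continuous_toFun := isQuotientMap_toProjectivePlane.continuous.comp (Path.continuous _)
      source' := by simp
      target' := by simp [IsCentrallySymmetric.vertex_inr D hD, toProjectivePlane_neg] }
  vertex_injective u v h := by
    rcases toProjectivePlane_eq_iff.1 h with h | h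
    · exact Sum.inl_injective (D.vertex_injective h)
    · rw [← IsCentrallySymmetric.vertex_inr D hD] at h
      exact absurd (D.vertex_injective h) Sum.inl_ne_inr
  arc_injective {u v} h s t hst := by
    rcases toProjectivePlane_eq_iff.1 hst with hst | hst
    · exact D.arc_injective _ hst
    · exfalso
      -- Antipodal points on one arc would be a meeting of the arcs of two different edges of the
      -- double cover. These have no common end.
      rw [← IsCentrallySymmetric.arc_inr_inl D hD h] at hst
      have := D.arc_disjoint _ _ s t (by simp [h.ne]) hst
      obtain ⟨rfl | rfl, rfl | rfl⟩ := this <;>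
        simp only [Path.source, Path.target] at hst <;>
        have := D.vertex_injective hst <;> simp [h.ne, h.ne'] at this
  arc_symm {u v} h := by
    ext t
    have := congrArg (fun p => p t) (D.arc_symm (bipartiteDoubleCover_adj_inl_inr h))
    have h2 := IsCentrallySymmetric.arc_inr_inl D hD h.symm t
    change toProjectivePlane (D.arc _ t) = toProjectivePlane (D.arc _ (σ t))
    rw [toProjectivePlane_eq_iff]
    right
    rw [← neg_eq_iff_eq_neg, ← h2]
    exact this
  arc_avoids_vertex {u v} h w t ht := by
    rcases toProjectivePlane_eq_iff.1 ht with ht | ht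
    · exact D.arc_avoids_vertex _ _ _ ht
    · rw [← IsCentrallySymmetric.vertex_inr D hD] at ht
      exact D.arc_avoids_vertex _ _ _ ht
  arc_disjoint {u v u' v'} h h' s t hne hst := by
    rcases toProjectivePlane_eq_iff.1 hst with hst | hst
    · refine D.arc_disjoint _ _ s t (fun h => hne ?_) hst
      simp only [Sym2.eq_iff, reduceCtorEq, Sum.inl.injEq, Sum.inr.injEq, and_false,
        or_false] at h ⊢
      tauto
    · rw [← IsCentrallySymmetric.arc_inr_inl D hD h'] at hst
      refine D.arc_disjoint _ _ s t (fun h => hne ?_) hst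
      simp only [Sym2.eq_iff, reduceCtorEq, Sum.inl.injEq, Sum.inr.injEq, and_false,
        false_or] at h ⊢
      tauto

theorem antipodalQuotient_isAntipodalQuotient :
    (D.antipodalQuotient hD).IsAntipodalQuotient D :=
  ⟨fun _ => rfl, fun _ _ _ _ => rfl⟩

/-- By uniqueness of lifts, the lift is one of the two antipodal arcs of the double cover, selected
by its starting point; either one changes colour. -/
theorem monodromy_antipodalQuotient_arc {u v : V} (h : G.Adj u v)
    (b : toProjectivePlane ⁻¹' {(D.antipodalQuotient hD).vertex u}) :
    (b.1 = D.vertex (Sum.inl u) → (isCoveringMap_toProjectivePlane.monodromy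
      (.mk ((D.antipodalQuotient hD).arc h)) b).1 = -D.vertex (Sum.inl v)) ∧
    (b.1 = -D.vertex (Sum.inl u) → (isCoveringMap_toProjectivePlane.monodromy
      (.mk ((D.antipodalQuotient hD).arc h)) b).1 = D.vertex (Sum.inl v)) := by
  constructor
  · intro hb
    have := (isCoveringMap_toProjectivePlane.eq_liftPath_iff'
      (γ := ((D.antipodalQuotient hD).arc h).toContinuousMap) (e := b.1)
      (γ_0 := (Path.source _).trans b.2.symm)
      (Γ := (D.arc (bipartiteDoubleCover_adj_inl_inr h)).toContinuousMap)).2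
      ⟨rfl, by simp [hb]⟩
    refine (congrArg (fun f : C(I, UnitSphere) => f 1) this).symm.trans ?_
    simp [IsCentrallySymmetric.vertex_inr D hD]
  · intro hb
    have := (isCoveringMap_toProjectivePlane.eq_liftPath_iff'
      (γ := ((D.antipodalQuotient hD).arc h).toContinuousMap) (e := b.1)
      (γ_0 := (Path.source _).trans b.2.symm)
      (Γ := (D.arc (bipartiteDoubleCover_adj_inr_inl h)).toContinuousMap)).2
      ⟨by
        ext t
        change toProjectivePlane (D.arc _ t) = toProjectivePlane (D.arc _ t)
        rw [IsCentrallySymmetric.arc_inr_inl D hD h, toProjectivePlane_neg],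
        by simp [hb, IsCentrallySymmetric.vertex_inr D hD]⟩
    refine (congrArg (fun f : C(I, UnitSphere) => f 1) this).symm.trans ?_
    simp

theorem monodromy_antipodalQuotient_walkPath {u v : V} (p : G.Walk u v)
    (b : toProjectivePlane ⁻¹' {(D.antipodalQuotient hD).vertex u}) :
    (b.1 = D.vertex (Sum.inl u) → (isCoveringMap_toProjectivePlane.monodromy
      (.mk ((D.antipodalQuotient hD).walkPath p)) b).1 =
        if Even p.length then D.vertex (Sum.inl v) else -D.vertex (Sum.inl v)) ∧
    (b.1 = -D.vertex (Sum.inl u) → (isCoveringMap_toProjectivePlane.monodromy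
      (.mk ((D.antipodalQuotient hD).walkPath p)) b).1 =
        if Even p.length then -D.vertex (Sum.inl v) else D.vertex (Sum.inl v)) := by
  induction p with
  | nil =>
    have : (isCoveringMap_toProjectivePlane.monodromy
      (.mk ((D.antipodalQuotient hD).walkPath .nil)) b) = b :=
      congrFun (isCoveringMap_toProjectivePlane.monodromy_refl) b
    rw [this]
    simp
  | @cons u w v h p ih =>
    have key : isCoveringMap_toProjectivePlane.monodromy
        (.mk ((D.antipodalQuotient hD).walkPath (.cons h p))) b =
        isCoveringMap_toProjectivePlane.monodromy (.mk ((D.antipodalQuotient hD).walkPath p))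
          (isCoveringMap_toProjectivePlane.monodromy (.mk ((D.antipodalQuotient hD).arc h)) b) :=
      isCoveringMap_toProjectivePlane.monodromy_trans_apply
        (.mk ((D.antipodalQuotient hD).arc h)) (.mk ((D.antipodalQuotient hD).walkPath p)) b
    rw [key]
    have h1 := monodromy_antipodalQuotient_arc D hD h b
    have h2 := ih (isCoveringMap_toProjectivePlane.monodromy
      (.mk ((D.antipodalQuotient hD).arc h)) b)
    constructor
    · intro hb
      rw [h2.2 (h1.1 hb), SimpleGraph.Walk.length_cons]
      by_cases hp : Even p.length <;> simp [hp, Nat.even_add_one]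
    · intro hb
      rw [h2.1 (h1.2 hb), SimpleGraph.Walk.length_cons]
      by_cases hp : Even p.length <;> simp [hp, Nat.even_add_one]

/-- A null-homotopic loop acts trivially on the fibre, whereas an odd number of colour changes sends
a point to its antipode. Only the parity of the closed walk matters. -/
theorem not_isContractible_walkPath_antipodalQuotient {u : V} (p : G.Walk u u)
    (hp : Odd p.length) : ¬ ((D.antipodalQuotient hD).walkPath p).IsContractible := by
  intro hc
  have h1 := (monodromy_antipodalQuotient_walkPath D hD p ⟨D.vertex (Sum.inl u), rfl⟩).1 rfl
  rw [Path.Homotopic.Quotient.eq.2 hc, if_neg (Nat.not_even_iff_odd.2 hp)] at h1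
  have h2 := congrFun (isCoveringMap_toProjectivePlane.monodromy_refl)
    (⟨D.vertex (Sum.inl u), rfl⟩ :
      toProjectivePlane ⁻¹' {(D.antipodalQuotient hD).vertex u})
  exact UnitSphere.ne_neg_self _ ((congrArg Subtype.val h2).symm.trans h1)

end AntipodalQuotient

end GraphEmbedding

/-! ### Radial projection. -/

section Radial

/-- The radial projection of a nonzero vector to the unit sphere. -/
noncomputable def radialProjection (v : EuclideanSpace ℝ (Fin 3)) (hv : v ≠ 0) : UnitSphere :=
  ⟨‖v‖⁻¹ • v, by simp [norm_smul, hv]⟩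

theorem radialProjection_eq_iff {v w : EuclideanSpace ℝ (Fin 3)} (hv : v ≠ 0) (hw : w ≠ 0) :
    radialProjection v hv = radialProjection w hw ↔ SameRay ℝ v w := by
  rw [sameRay_iff_inv_norm_smul_eq_of_ne hv hw, radialProjection, radialProjection,
    Subtype.mk.injEq]

theorem neg_radialProjection {v : EuclideanSpace ℝ (Fin 3)} (hv : v ≠ 0) :
    -radialProjection v hv = radialProjection (-v) (neg_ne_zero.2 hv) := by
  ext1
  simp [radialProjection]

theorem continuous_radialProjection {X : Type*} [TopologicalSpace X]
    {f : X → EuclideanSpace ℝ (Fin 3)} (hf : Continuous f) (h0 : ∀ x, f x ≠ 0) :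
    Continuous fun x => radialProjection (f x) (h0 x) :=
  Continuous.subtype_mk ((hf.norm.inv₀ fun x => norm_ne_zero_iff.2 (h0 x)).smul hf) _

end Radial

/-! ### Star systems: the linear data behind a symmetric drawing. -/

section StarSystem

variable {V E : Type*} [AddCommGroup E] [Module ℝ E]

/-- The point at parameter `s` of the segment from the hub `c x` to the point `m x y`. -/
def halfEdge (c : V → E) (m : V → V → E) (x y : V) (s : ℝ) : E := (1 - s) • c x + s • m x y

/-- The parameters of the points of the star of a vertex `x ∈ S`: the hub, and the points on the
half-edges towards the neighbours of `x` in `S`. -/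
def IsStarPoint (G : SimpleGraph V) (S : Set V) (x y : V) (s : ℝ) : Prop :=
  x ∈ S ∧ 0 ≤ s ∧ s ≤ 1 ∧ (s = 0 ∨ y ∈ S ∧ G.Adj x y)

/-- Hubs `c x` and midpoints `m x y` of the vertices and edges of `G` on `S` whose radial projection
is half of a centrally symmetric drawing of the bipartite double cover: stars of different vertices
are disjoint, and a star meets the antipode of another one only in the midpoint of an edge. -/
structure IsStarSystem (G : SimpleGraph V) (S : Set V) (c : V → E) (m : V → V → E) : Prop where
  midpoint_symm : ∀ x ∈ S, ∀ y ∈ S, G.Adj x y → m y x = -m x y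
  ne_zero : ∀ {x y s}, IsStarPoint G S x y s → halfEdge c m x y s ≠ 0
  eq_of_sameRay : ∀ {x y s x' y' s'}, IsStarPoint G S x y s → IsStarPoint G S x' y' s' →
    SameRay ℝ (halfEdge c m x y s) (halfEdge c m x' y' s') → x = x' ∧ s = s' ∧ (s = 0 ∨ y = y')
  eq_of_sameRay_neg : ∀ {x y s x' y' s'}, IsStarPoint G S x y s → IsStarPoint G S x' y' s' →
    SameRay ℝ (halfEdge c m x y s) (-halfEdge c m x' y' s') → x' = y ∧ y' = x ∧ s = 1 ∧ s' = 1

theorem IsStarSystem.comap {W : Type*} {G : SimpleGraph V} {S : Set V} {c : V → E}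
    {m : V → V → E} (h : IsStarSystem G S c m) {H : SimpleGraph W} (f : W → V)
    (hf : Function.Injective f) (hS : ∀ w, f w ∈ S) (hadj : ∀ v w, H.Adj v w → G.Adj (f v) (f w)) :
    IsStarSystem H Set.univ (fun w => c (f w)) (fun v w => m (f v) (f w)) := by
  have key : ∀ {x y s}, IsStarPoint H Set.univ x y s → IsStarPoint G S (f x) (f y) s :=
    fun ⟨_, h0, h1, h2⟩ => ⟨hS _, h0, h1, h2.imp_right fun h => ⟨hS _, hadj _ _ h.2⟩⟩
  constructor
  · exact fun x _ y _ hxy => h.midpoint_symm _ (hS x) _ (hS y) (hadj _ _ hxy)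
  · exact fun hp => h.ne_zero (key hp)
  · intro x y s x' y' s' hp hq hr
    obtain ⟨h1, h2, h3⟩ := h.eq_of_sameRay (key hp) (key hq) hr
    exact ⟨hf h1, h2, h3.imp_right fun h => hf h⟩
  · intro x y s x' y' s' hp hq hr
    obtain ⟨h1, h2, h3⟩ := h.eq_of_sameRay_neg (key hp) (key hq) hr
    exact ⟨hf h1, hf h2, h3⟩

end StarSystem

/-! ### From star systems to polylines for the edges of the double cover. -/

section Polyline

variable {V E : Type*} [AddCommGroup E] [Module ℝ E]

/-- The vertex of `G` below a vertex of the double cover. -/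
def coverBase : V ⊕ V → V := Sum.elim id id

/-- The sign of a vertex of the double cover. -/
def coverSign : V ⊕ V → ℝ := Sum.elim (fun _ => 1) (fun _ => -1)

theorem coverSign_eq_or (w : V ⊕ V) : coverSign w = 1 ∨ coverSign w = -1 := by
  cases w <;> simp [coverSign]

theorem coverSign_swap (w : V ⊕ V) : coverSign w.swap = -coverSign w := by
  cases w <;> simp [coverSign]

theorem coverBase_swap (w : V ⊕ V) : coverBase w.swap = coverBase w := by
  cases w <;> simp [coverBase]

theorem cover_ext {v w : V ⊕ V} (h : coverSign v = coverSign w) (h' : coverBase v = coverBase w) :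
    v = w := by
  cases v <;> cases w <;> simp_all [coverSign, coverBase] <;> norm_num at h

theorem coverSign_of_adj {G : SimpleGraph V} {v w : V ⊕ V} (h : G.bipartiteDoubleCover.Adj v w) :
    coverSign w = -coverSign v := by
  cases v <;> cases w <;> simp_all [coverSign]

theorem coverBase_of_adj {G : SimpleGraph V} {v w : V ⊕ V} (h : G.bipartiteDoubleCover.Adj v w) :
    G.Adj (coverBase v) (coverBase w) := by
  cases v <;> cases w <;> simp_all [coverBase]

/-- The polyline that joins the hubs of two adjacent vertices of the double cover. -/
noncomputable def coverPolyline (c : V → E) (m : V → V → E) (v w : V ⊕ V) (t : ℝ) : E :=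
  max (1 - 2 * t) 0 • coverSign v • c (coverBase v) +
    (1 - |2 * t - 1|) • coverSign v • m (coverBase v) (coverBase w) +
    max (2 * t - 1) 0 • coverSign w • c (coverBase w)

theorem coverPolyline_swap (c : V → E) (m : V → V → E) (v w : V ⊕ V) (t : ℝ) :
    coverPolyline c m v.swap w.swap t = -coverPolyline c m v w t := by
  simp only [coverPolyline, coverSign_swap, coverBase_swap]
  module

theorem coverPolyline_of_le (c : V → E) (m : V → V → E) (v w : V ⊕ V) {t : ℝ} (ht : t ≤ 1 / 2) :
    coverPolyline c m v w t = coverSign v • halfEdge c m (coverBase v) (coverBase w) (2 * t) := by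
  rw [coverPolyline, halfEdge, max_eq_left (by linarith), max_eq_right (by linarith),
    abs_of_nonpos (by linarith)]
  module

variable {G : SimpleGraph V} {c : V → E} {m : V → V → E} (h : IsStarSystem G Set.univ c m)
include h

/-- Adjacent vertices have opposite signs, which cancels the sign in `m y x = -m x y`. This reduces
questions about the second half of a polyline to the first half, where it is a signed half-edge. -/
theorem IsStarSystem.coverPolyline_symm {v w : V ⊕ V} (hvw : G.bipartiteDoubleCover.Adj v w)
    (t : ℝ) : coverPolyline c m w v (1 - t) = coverPolyline c m v w t := by
  have h1 : 1 - 2 * (1 - t) = 2 * t - 1 := by ring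
  have h2 : 2 * (1 - t) - 1 = 1 - 2 * t := by ring
  rw [coverPolyline, coverPolyline, h1, h2, coverSign_of_adj hvw, abs_sub_comm 1,
    h.midpoint_symm _ trivial _ trivial (coverBase_of_adj hvw)]
  module

theorem IsStarSystem.eq_of_sameRay_smul {ε ε' : ℝ} (hε : ε = 1 ∨ ε = -1) (hε' : ε' = 1 ∨ ε' = -1)
    {x y s x' y' s'} (hp : IsStarPoint G Set.univ x y s) (hq : IsStarPoint G Set.univ x' y' s')
    (hr : SameRay ℝ (ε • halfEdge c m x y s) (ε' • halfEdge c m x' y' s')) :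
    (ε = ε' ∧ x = x' ∧ s = s' ∧ (s = 0 ∨ y = y')) ∨
      (ε = -ε' ∧ x' = y ∧ y' = x ∧ s = 1 ∧ s' = 1) := by
  rcases hε with rfl | rfl <;> rcases hε' with rfl | rfl <;>
    simp only [one_smul, neg_smul] at hr
  · exact Or.inl ⟨rfl, h.eq_of_sameRay hp hq hr⟩
  · exact Or.inr ⟨(neg_neg _).symm, h.eq_of_sameRay_neg hp hq hr⟩
  · exact Or.inr ⟨rfl, h.eq_of_sameRay_neg hp hq (by simpa using hr.neg)⟩
  · exact Or.inl ⟨rfl, h.eq_of_sameRay hp hq (by simpa using hr.neg)⟩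

theorem IsStarSystem.eq_of_sameRay_coverPolyline_of_le {v w v' w' : V ⊕ V}
    (hvw : G.bipartiteDoubleCover.Adj v w) (hvw' : G.bipartiteDoubleCover.Adj v' w') {t t' : ℝ}
    (ht : 0 ≤ t) (ht1 : t ≤ 1 / 2) (ht' : 0 ≤ t') (ht1' : t' ≤ 1 / 2)
    (hr : SameRay ℝ (coverPolyline c m v w t) (coverPolyline c m v' w' t')) :
    (v = v' ∧ w = w' ∧ t = t') ∨ (v = w' ∧ w = v' ∧ t = 1 - t') ∨ (v = v' ∧ t = 0 ∧ t' = 0) := by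
  rw [coverPolyline_of_le _ _ _ _ ht1, coverPolyline_of_le _ _ _ _ ht1'] at hr
  rcases h.eq_of_sameRay_smul (coverSign_eq_or _) (coverSign_eq_or _)
    ⟨trivial, by linarith, by linarith, Or.inr ⟨trivial, coverBase_of_adj hvw⟩⟩
    ⟨trivial, by linarith, by linarith, Or.inr ⟨trivial, coverBase_of_adj hvw'⟩⟩ hr with
    ⟨h1, h2, h3, h4⟩ | ⟨h1, h2, h3, h4, h5⟩
  · have hv := cover_ext h1 h2
    rcases h4 with h4 | h4
    · exact Or.inr (Or.inr ⟨hv, by linarith, by linarith⟩)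
    · refine Or.inl ⟨hv, cover_ext ?_ h4, by linarith⟩
      rw [coverSign_of_adj hvw, coverSign_of_adj hvw', h1]
  · refine Or.inr (Or.inl ⟨cover_ext ?_ h3.symm, cover_ext ?_ h2.symm, by linarith⟩)
    · rw [coverSign_of_adj hvw', h1]
    · rw [coverSign_of_adj hvw, h1, neg_neg]

theorem IsStarSystem.eq_of_sameRay_coverPolyline {v w v' w' : V ⊕ V}
    (hvw : G.bipartiteDoubleCover.Adj v w) (hvw' : G.bipartiteDoubleCover.Adj v' w') {t t' : ℝ}
    (ht : 0 ≤ t) (ht1 : t ≤ 1) (ht' : 0 ≤ t') (ht1' : t' ≤ 1)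
    (hr : SameRay ℝ (coverPolyline c m v w t) (coverPolyline c m v' w' t')) :
    (v = v' ∧ w = w' ∧ t = t') ∨ (v = w' ∧ w = v' ∧ t = 1 - t') ∨ (v = v' ∧ t = 0 ∧ t' = 0) ∨
      (v = w' ∧ t = 0 ∧ t' = 1) ∨ (w = v' ∧ t = 1 ∧ t' = 0) ∨ (w = w' ∧ t = 1 ∧ t' = 1) := by
  rcases le_total t (1 / 2) with h1 | h1 <;> rcases le_total t' (1 / 2) with h2 | h2
  · have := h.eq_of_sameRay_coverPolyline_of_le hvw hvw' ht h1 ht' h2 hr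
    tauto
  · rw [← h.coverPolyline_symm hvw'] at hr
    rcases h.eq_of_sameRay_coverPolyline_of_le hvw hvw'.symm ht h1 (by linarith) (by linarith) hr
      with ⟨h3, h4, h5⟩ | ⟨h3, h4, h5⟩ | ⟨h3, h4, h5⟩
    · exact Or.inr (Or.inl ⟨h3, h4, h5⟩)
    · exact Or.inl ⟨h3, h4, by linarith⟩
    · exact Or.inr (Or.inr (Or.inr (Or.inl ⟨h3, h4, by linarith⟩)))
  · rw [← h.coverPolyline_symm hvw] at hr
    rcases h.eq_of_sameRay_coverPolyline_of_le hvw.symm hvw' (by linarith) (by linarith) ht' h2 hr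
      with ⟨h3, h4, h5⟩ | ⟨h3, h4, h5⟩ | ⟨h3, h4, h5⟩
    · exact Or.inr (Or.inl ⟨h4, h3, by linarith⟩)
    · exact Or.inl ⟨h4, h3, by linarith⟩
    · exact Or.inr (Or.inr (Or.inr (Or.inr (Or.inl ⟨h3, by linarith, h5⟩))))
  · rw [← h.coverPolyline_symm hvw, ← h.coverPolyline_symm hvw'] at hr
    rcases h.eq_of_sameRay_coverPolyline_of_le hvw.symm hvw'.symm (by linarith) (by linarith)
      (by linarith) (by linarith) hr with ⟨h3, h4, h5⟩ | ⟨h3, h4, h5⟩ | ⟨h3, h4, h5⟩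
    · exact Or.inl ⟨h4, h3, by linarith⟩
    · exact Or.inr (Or.inl ⟨h4, h3, by linarith⟩)
    · exact Or.inr (Or.inr (Or.inr (Or.inr (Or.inr ⟨h3, by linarith, by linarith⟩))))

theorem IsStarSystem.coverPolyline_ne_zero {v w : V ⊕ V} (hvw : G.bipartiteDoubleCover.Adj v w)
    {t : ℝ} (ht : 0 ≤ t) (ht1 : t ≤ 1) : coverPolyline c m v w t ≠ 0 := by
  have key : ∀ {v w : V ⊕ V} (_ : G.bipartiteDoubleCover.Adj v w) {t : ℝ} (_ : 0 ≤ t)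
      (_ : t ≤ 1 / 2), coverPolyline c m v w t ≠ 0 := by
    intro v w hvw t ht ht1
    rw [coverPolyline_of_le _ _ _ _ ht1]
    refine smul_ne_zero ?_ (h.ne_zero
      ⟨trivial, by linarith, by linarith, Or.inr ⟨trivial, coverBase_of_adj hvw⟩⟩)
    rcases coverSign_eq_or v with h | h <;> rw [h] <;> norm_num
  rcases le_total t (1 / 2) with h1 | h1
  · exact key hvw ht h1
  · rw [← h.coverPolyline_symm hvw]
    exact key hvw.symm (by linarith) (by linarith)

theorem IsStarSystem.hub_ne_zero (v : V ⊕ V) : coverSign v • c (coverBase v) ≠ 0 := by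
  have := h.ne_zero (x := coverBase v) (y := coverBase v) (s := 0)
    ⟨trivial, le_rfl, zero_le_one, Or.inl rfl⟩
  refine smul_ne_zero ?_ (by simpa [halfEdge] using this)
  rcases coverSign_eq_or v with h | h <;> rw [h] <;> norm_num

theorem IsStarSystem.eq_of_sameRay_hub {v w : V ⊕ V}
    (hr : SameRay ℝ (coverSign v • c (coverBase v)) (coverSign w • c (coverBase w))) : v = w := by
  -- At parameter 0 the second vertex is irrelevant, so `x` itself can serve although it is no
  -- neighbour.
  have e : ∀ x, c x = halfEdge c m x x 0 := fun x => by simp [halfEdge]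
  rw [e, e] at hr
  rcases h.eq_of_sameRay_smul (coverSign_eq_or _) (coverSign_eq_or _)
    ⟨trivial, le_rfl, zero_le_one, Or.inl rfl⟩ ⟨trivial, le_rfl, zero_le_one, Or.inl rfl⟩ hr with
    ⟨h1, h2, -, -⟩ | ⟨-, -, -, h4, -⟩
  · exact cover_ext h1 h2
  · norm_num at h4

theorem IsStarSystem.eq_of_sameRay_coverPolyline_hub {v w v' : V ⊕ V}
    (hvw : G.bipartiteDoubleCover.Adj v w) {t : ℝ} (ht : 0 ≤ t) (ht1 : t ≤ 1)
    (hr : SameRay ℝ (coverPolyline c m v w t) (coverSign v' • c (coverBase v'))) :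
    t = 0 ∨ t = 1 := by
  have key : ∀ {v w : V ⊕ V} (_ : G.bipartiteDoubleCover.Adj v w) {t : ℝ} (_ : 0 ≤ t)
      (_ : t ≤ 1 / 2)
      (_ : SameRay ℝ (coverPolyline c m v w t) (coverSign v' • c (coverBase v'))), t = 0 := by
    intro v w hvw t ht ht1 hr
    have e : ∀ x, c x = halfEdge c m x x 0 := fun x => by simp [halfEdge]
    rw [coverPolyline_of_le _ _ _ _ ht1, e] at hr
    rcases h.eq_of_sameRay_smul (coverSign_eq_or _) (coverSign_eq_or _)
      ⟨trivial, by linarith, by linarith, Or.inr ⟨trivial, coverBase_of_adj hvw⟩⟩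
      ⟨trivial, le_rfl, zero_le_one, Or.inl rfl⟩ hr with ⟨-, -, h3, -⟩ | ⟨-, -, -, -, h4⟩
    · linarith
    · norm_num at h4
  rcases le_total t (1 / 2) with h1 | h1
  · exact Or.inl (key hvw ht h1 hr)
  · rw [← h.coverPolyline_symm hvw] at hr
    have := key hvw.symm (by linarith) (by linarith) hr
    exact Or.inr (by linarith)

end Polyline

/-! ### The drawing on the sphere. -/

section Drawing

variable {V : Type*} {G : SimpleGraph V} {c : V → EuclideanSpace ℝ (Fin 3)}
  {m : V → V → EuclideanSpace ℝ (Fin 3)} (h : IsStarSystem G Set.univ c m)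

/-- The radial projection of a star system as a drawing of the bipartite double cover. -/
noncomputable def IsStarSystem.drawing : GraphEmbedding G.bipartiteDoubleCover UnitSphere where
  vertex v := radialProjection (coverSign v • c (coverBase v)) (h.hub_ne_zero v)
  arc {v w} hvw :=
    { toFun := fun t => radialProjection (coverPolyline c m v w t)
        (h.coverPolyline_ne_zero hvw t.2.1 t.2.2)
      continuous_toFun := continuous_radialProjection (by unfold coverPolyline; fun_prop) _
      source' := by simp [coverPolyline]
      target' := by
        have : coverPolyline c m v w 1 = coverSign w • c (coverBase w) := by
          norm_num [coverPolyline]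
        simp [this] }
  vertex_injective v w hvw := h.eq_of_sameRay_hub ((radialProjection_eq_iff _ _).1 hvw)
  arc_injective {v w} hvw t t' htt' := by
    have := h.eq_of_sameRay_coverPolyline hvw hvw t.2.1 t.2.2 t'.2.1 t'.2.2
      ((radialProjection_eq_iff (h.coverPolyline_ne_zero hvw t.2.1 t.2.2)
        (h.coverPolyline_ne_zero hvw t'.2.1 t'.2.2)).1 htt')
    ext1
    rcases this with ⟨-, -, h3⟩ | ⟨h3, -, -⟩ | ⟨-, h3, h4⟩ | ⟨h3, -, -⟩ | ⟨h3, -, -⟩ | ⟨-, h3, h4⟩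
    · exact h3
    · exact absurd h3 hvw.ne
    · rw [h3, h4]
    · exact absurd h3 hvw.ne
    · exact absurd h3 hvw.ne'
    · rw [h3, h4]
  arc_symm {v w} hvw := by
    ext1
    funext t
    refine (radialProjection_eq_iff (h.coverPolyline_ne_zero hvw.symm t.2.1 t.2.2)
      (h.coverPolyline_ne_zero hvw (σ t).2.1 (σ t).2.2)).2 ?_
    rw [unitInterval.coe_symm_eq, ← h.coverPolyline_symm hvw, sub_sub_cancel]
  arc_avoids_vertex {v w} hvw v' t ht := by
    have := h.eq_of_sameRay_coverPolyline_hub hvw t.2.1 t.2.2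
      ((radialProjection_eq_iff (h.coverPolyline_ne_zero hvw t.2.1 t.2.2) (h.hub_ne_zero v')).1 ht)
    exact this.imp (fun h => Subtype.ext h) (fun h => Subtype.ext h)
  arc_disjoint {v w v' w'} hvw hvw' t t' hne htt' := by
    have := h.eq_of_sameRay_coverPolyline hvw hvw' t.2.1 t.2.2 t'.2.1 t'.2.2
      ((radialProjection_eq_iff (h.coverPolyline_ne_zero hvw t.2.1 t.2.2)
        (h.coverPolyline_ne_zero hvw' t'.2.1 t'.2.2)).1 htt')
    simp only [ne_eq, Sym2.eq_iff] at hne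
    have e0 : ∀ t : I, t = 0 ↔ (t : ℝ) = 0 := fun t => Subtype.ext_iff
    have e1 : ∀ t : I, t = 1 ↔ (t : ℝ) = 1 := fun t => Subtype.ext_iff
    rw [e0, e1, e0, e1]
    tauto

theorem IsStarSystem.drawing_isCentrallySymmetric : h.drawing.IsCentrallySymmetric := by
  constructor
  · intro w
    refine Eq.trans ?_ (neg_radialProjection (h.hub_ne_zero w)).symm
    simp [drawing, coverSign_swap, coverBase_swap]
  · intro w w' hw t
    refine Eq.trans ?_ (neg_radialProjection (h.coverPolyline_ne_zero hw t.2.1 t.2.2)).symm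
    change radialProjection (coverPolyline c m w.swap w'.swap t)
      (h.coverPolyline_ne_zero (bipartiteDoubleCover_adj_swap hw) t.2.1 t.2.2) = _
    simp only [coverPolyline_swap]

end Drawing

/-! ### Small perturbations in generic directions. -/

section Generic

variable {E : Type*} [NormedAddCommGroup E] [NormedSpace ℝ E]

/-- Lying on a common ray is the closed condition `‖p‖ • v = ‖v‖ • p`; compactness of the parameter
interval makes its failure stable under small shifts of `v`. -/
theorem eventually_forall_not_sameRay_add_smul {p : ℝ → E} (hp : Continuous p) (v d : E)
    (h : ∀ s ∈ Set.Icc (0 : ℝ) 1, ¬ SameRay ℝ (p s) v) :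
    ∀ᶠ r in nhds (0 : ℝ), ∀ s ∈ Set.Icc (0 : ℝ) 1, ¬ SameRay ℝ (p s) (v + r • d) := by
  refine isCompact_Icc.eventually_forall_of_forall_eventually fun s hs => ?_
  simp only [sameRay_iff_norm_smul_eq] at h ⊢
  have h1 : ContinuousAt (fun z : ℝ × ℝ => ‖p z.2‖ • (v + z.1 • d)) (0, s) := by fun_prop
  have h2 : ContinuousAt (fun z : ℝ × ℝ => ‖v + z.1 • d‖ • p z.2) (0, s) := by fun_prop
  exact ((h1.sub h2).eventually_ne (sub_ne_zero.2 (by simpa using h s hs))).mono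
    fun z hz => sub_ne_zero.1 hz

/-- A real vector space is not a finite union of proper subspaces. -/
theorem exists_forall_notMem_span_pair [FiniteDimensional ℝ E] (hE : 2 < Module.finrank ℝ E)
    {ι : Type*} [Finite ι] (u : E) (v : ι → E) : ∃ d, ∀ i, d ∉ Submodule.span ℝ {u, v i} := by
  by_contra! hd
  obtain ⟨i, hi⟩ := Subspace.exists_eq_top_of_iUnion_eq_univ (k := ℝ)
    (p := fun i => Submodule.span ℝ {u, v i})
    (Set.eq_univ_of_forall fun d => Set.mem_iUnion.2 (hd d))
  classical
  have h1 := finrank_span_finset_le_card (R := ℝ) (M := E) {u, v i}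
  rw [Finset.coe_pair, Set.finrank, hi, finrank_top] at h1
  exact absurd (h1.trans Finset.card_le_two) (by omega)

variable {u d : E} (hd : d ∉ Submodule.span ℝ {u}) (hu : u ≠ 0)
include hd hu

theorem add_smul_ne_zero_of_notMem_span (r : ℝ) : u + r • d ≠ 0 := by
  intro h
  rcases eq_or_ne r 0 with rfl | hr
  · exact hu (by simpa using h)
  · refine hd (Submodule.mem_span_singleton.2 ⟨-r⁻¹, ?_⟩)
    have : u = -(r • d) := eq_neg_of_add_eq_zero_left h
    rw [this, smul_neg, neg_smul, neg_neg, inv_smul_smul₀ hr]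

theorem smul_add_smul_eq_of_notMem_span {a b a' b' : ℝ} (h : a • u + b • d = a' • u + b' • d) :
    a = a' ∧ b = b' := by
  have h1 : (b - b') • d = (a' - a) • u := by
    rw [sub_smul, sub_smul, sub_eq_sub_iff_add_eq_add, add_comm, h, add_comm]
  have hb : b - b' = 0 := by
    by_contra hb
    refine hd (Submodule.mem_span_singleton.2 ⟨(b - b')⁻¹ * (a' - a), ?_⟩)
    rw [mul_smul, ← h1, inv_smul_smul₀ hb]
  rw [hb, zero_smul, eq_comm, smul_eq_zero, or_iff_left hu] at h1
  exact ⟨by linarith, by linarith⟩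

theorem eq_of_sameRay_add_smul {r r' : ℝ} (h : SameRay ℝ (u + r • d) (u + r' • d)) : r = r' := by
  obtain ⟨a, b, ha, hb, hab⟩ := h.exists_pos (add_smul_ne_zero_of_notMem_span hd hu r)
    (add_smul_ne_zero_of_notMem_span hd hu r')
  rw [smul_add, smul_add, smul_smul, smul_smul] at hab
  obtain ⟨rfl, h2⟩ := smul_add_smul_eq_of_notMem_span hd hu hab
  exact mul_left_cancel₀ ha.ne' h2

theorem not_sameRay_neg_add_smul {r r' : ℝ} : ¬ SameRay ℝ (u + r • d) (-(u + r' • d)) := by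
  intro h
  obtain ⟨a, b, ha, hb, hab⟩ := h.exists_pos (add_smul_ne_zero_of_notMem_span hd hu r)
    (neg_ne_zero.2 (add_smul_ne_zero_of_notMem_span hd hu r'))
  have hab' : a • u + (a * r) • d = (-b) • u + (-(b * r')) • d := by
    rw [smul_add, smul_smul] at hab
    rw [hab]
    module
  obtain ⟨h1, -⟩ := smul_add_smul_eq_of_notMem_span hd hu hab'
  linarith

end Generic

theorem notMem_span_of_sameRay_add_smul {E : Type*} [NormedAddCommGroup E] [NormedSpace ℝ E]
    {u w d q : E} {r : ℝ} (hd : d ∉ Submodule.span ℝ {u, w}) (hr : r ≠ 0)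
    (hq : q ∈ Submodule.span ℝ {u, w}) (hq0 : q ≠ 0) (h0 : u + r • d ≠ 0) :
    ¬ SameRay ℝ q (u + r • d) := by
  intro h
  obtain ⟨a, b, ha, hb, hab⟩ := h.exists_pos hq0 h0
  apply hd
  have h1 : d = (b * r)⁻¹ • (a • q - b • u) := by
    rw [hab, smul_add, add_sub_cancel_left, smul_smul b r, inv_smul_smul₀ (mul_ne_zero hb.ne' hr)]
  rw [h1]
  have hu : u ∈ Submodule.span ℝ {u, w} := Submodule.subset_span (by simp)
  exact Submodule.smul_mem _ _ (Submodule.sub_mem _ (Submodule.smul_mem _ _ hq)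
    (Submodule.smul_mem _ _ hu))

/-! ### Adding a vertex of degree at most one. -/

section Extension

variable {V : Type*} {G : SimpleGraph V}

theorem isStarSystem_empty {E : Type*} [AddCommGroup E] [Module ℝ E] (c : V → E) (m : V → V → E) :
    IsStarSystem G ∅ c m :=
  ⟨fun _ h => h.elim, fun h => h.1.elim, fun h => h.1.elim, fun h => h.1.elim⟩

theorem isStarSystem_singleton {E : Type*} [AddCommGroup E] [Module ℝ E] (y : V) {c : V → E}
    (hc : c y ≠ 0) (m : V → V → E) : IsStarSystem G {y} c m := by
  have key : ∀ {a b s}, IsStarPoint G {y} a b s → a = y ∧ s = 0 ∧ halfEdge c m a b s = c y := by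
    rintro a b s ⟨rfl, -, -, rfl | ⟨rfl, h⟩⟩
    · simp [halfEdge]
    · exact absurd h (G.loopless.irrefl _)
  constructor
  · rintro _ rfl _ rfl h
    exact absurd h (G.loopless.irrefl _)
  · intro a b s h
    rw [(key h).2.2]
    exact hc
  · intro a b s a' b' s' h h' _
    exact ⟨(key h).1.trans (key h').1.symm, (key h).2.1.trans (key h').2.1.symm, Or.inl (key h).2.1⟩
  · intro a b s a' b' s' h h' hr
    rw [(key h).2.2, (key h').2.2] at hr
    exact absurd (eq_zero_of_sameRay_self_neg hr) hc

variable {E : Type*} [NormedAddCommGroup E] [NormedSpace ℝ E] [FiniteDimensional ℝ E]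

/-- The new edge and the antipode of the star of `y` run along a short segment from `c x` in a
direction `d` outside the planes of the half-edges at `x`. Other stars, and all antipodal stars,
avoid the ray of `c x` and hence, by compactness, the segment. If `y` has no neighbour in `S`, any
`x` will do. -/
theorem IsStarSystem.exists_insert (hE : 2 < Module.finrank ℝ E) {S : Set V} (hS : S.Finite)
    {c : V → E} {m : V → V → E} (h : IsStarSystem G S c m) {x y : V} (hx : x ∈ S) (hy : y ∉ S)
    (hxy : ∀ z ∈ S, G.Adj y z → z = x) : ∃ c' m', IsStarSystem (E := E) G (insert y S) c' m' := by
  classical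
  have hne : x ≠ y := fun e => hy (e ▸ hx)
  have hub : ∀ a b, halfEdge c m a b 0 = c a := fun a b => by simp [halfEdge]
  have hubPoint : ∀ a b, a ∈ S → IsStarPoint G S a b 0 :=
    fun a b ha => ⟨ha, le_rfl, zero_le_one, Or.inl rfl⟩
  have hcx : c x ≠ 0 := hub x x ▸ h.ne_zero (hubPoint x x hx)
  have : Finite S := hS
  obtain ⟨d, hd⟩ := exists_forall_notMem_span_pair hE (c x) fun b : S => m x b
  have hd' : d ∉ Submodule.span ℝ {c x} := fun hm =>
    hd ⟨x, hx⟩ (Submodule.span_mono (by simp) hm)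
  have hnz := add_smul_ne_zero_of_notMem_span hd' hcx
  have hpos : ∀ a b s, IsStarPoint G S a b s → a ≠ x → ¬ SameRay ℝ (halfEdge c m a b s) (c x) := by
    intro a b s hp ha hr
    rw [← hub x x] at hr
    exact ha (h.eq_of_sameRay hp (hubPoint x x hx) hr).1
  have hneg : ∀ a b s, IsStarPoint G S a b s → ¬ SameRay ℝ (halfEdge c m a b s) (-c x) := by
    intro a b s hp hr
    rw [← hub x x] at hr
    exact zero_ne_one (h.eq_of_sameRay_neg hp (hubPoint x x hx) hr).2.2.2
  have hcont : ∀ a b, Continuous (halfEdge c m a b) := fun a b => by unfold halfEdge; fun_prop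
  have ev1 : ∀ᶠ r in nhds (0 : ℝ), ∀ a ∈ S, ∀ b ∈ S, a ≠ x → G.Adj a b → ∀ s ∈ Set.Icc (0 : ℝ) 1,
      ¬ SameRay ℝ (halfEdge c m a b s) (c x + r • d) := by
    refine (Filter.eventually_all_finite hS).2 fun a ha => (Filter.eventually_all_finite hS).2
      fun b hb => ?_
    by_cases hab : a ≠ x ∧ G.Adj a b
    · filter_upwards [eventually_forall_not_sameRay_add_smul (hcont a b) (c x) d fun s hs =>
        hpos a b s ⟨ha, hs.1, hs.2, Or.inr ⟨hb, hab.2⟩⟩ hab.1] with r hr _ _ using hr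
    · exact Filter.Eventually.of_forall fun r h1 h2 => absurd ⟨h1, h2⟩ hab
  have ev2 : ∀ᶠ r in nhds (0 : ℝ), ∀ a ∈ S, ∀ b ∈ S, G.Adj a b → ∀ s ∈ Set.Icc (0 : ℝ) 1,
      ¬ SameRay ℝ (halfEdge c m a b s) (-(c x + r • d)) := by
    refine (Filter.eventually_all_finite hS).2 fun a ha => (Filter.eventually_all_finite hS).2
      fun b hb => ?_
    by_cases hab : G.Adj a b
    · filter_upwards [eventually_forall_not_sameRay_add_smul (hcont a b) (-c x) (-d) fun s hs =>
        hneg a b s ⟨ha, hs.1, hs.2, Or.inr ⟨hb, hab⟩⟩] with r hr _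
      simpa only [smul_neg, ← neg_add] using hr
    · exact Filter.Eventually.of_forall fun r h1 => absurd h1 hab
  have ev3 : ∀ᶠ r in nhds (0 : ℝ), ∀ a ∈ S, a ≠ x → ¬ SameRay ℝ (c a) (c x + r • d) := by
    refine (Filter.eventually_all_finite hS).2 fun a ha => ?_
    by_cases hax : a = x
    · exact Filter.Eventually.of_forall fun r h1 => absurd hax h1
    · filter_upwards [eventually_forall_not_sameRay_add_smul continuous_const (c x) d fun s _ =>
        hub a a ▸ hpos a a 0 (hubPoint a a ha) hax] with r hr _ using hr 0 (by simp)
  have ev4 : ∀ᶠ r in nhds (0 : ℝ), ∀ a ∈ S, ¬ SameRay ℝ (c a) (-(c x + r • d)) := by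
    refine (Filter.eventually_all_finite hS).2 fun a ha => ?_
    filter_upwards [eventually_forall_not_sameRay_add_smul continuous_const (-c x) (-d) fun s _ =>
        hub a a ▸ hneg a a 0 (hubPoint a a ha)] with r hr
    simpa only [smul_neg, ← neg_add] using hr 0 (by simp)
  obtain ⟨ε, hε, hball⟩ := Metric.eventually_nhds_iff.1 ((ev1.and ev2).and (ev3.and ev4))
  obtain ⟨δ, hδ, hδε⟩ : ∃ δ : ℝ, 0 < δ ∧ 2 * δ < ε := ⟨ε / 4, by linarith, by linarith⟩
  have far : ∀ {a b s r}, IsStarPoint G S a b s → 0 < r → r ≤ 2 * δ →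
      ¬ SameRay ℝ (halfEdge c m a b s) (c x + r • d) := by
    intro a b s r hp hr hr'
    obtain ⟨⟨h1, -⟩, h3, -⟩ := hball (y := r) (by rw [Real.dist_0_eq_abs, abs_of_pos hr]; linarith)
    -- The star of `x` itself contains `c x`, so compactness gives nothing here; the choice of `d`
    -- off its planes is what separates it from the segment.
    rcases eq_or_ne a x with rfl | hax
    · obtain ⟨b', hb', hmem⟩ : ∃ b' : S, m a b' = m a b' ∧
          halfEdge c m a b s ∈ Submodule.span ℝ {c a, m a b'} := by
        rcases hp.2.2.2 with rfl | ⟨hb, -⟩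
        · exact ⟨⟨a, hx⟩, rfl, by rw [hub]; exact Submodule.subset_span (by simp)⟩
        · exact ⟨⟨b, hb⟩, rfl, Submodule.mem_span_pair.2 ⟨_, _, rfl⟩⟩
      exact notMem_span_of_sameRay_add_smul (hd b') hr.ne' hmem (h.ne_zero hp) (hnz r)
    · rcases hp.2.2.2 with rfl | ⟨hb, hab⟩
      · rw [hub]
        exact h3 a hp.1 hax
      · exact h1 a hp.1 b hb hax hab s ⟨hp.2.1, hp.2.2.1⟩
  have farNeg : ∀ {a b s r}, IsStarPoint G S a b s → 0 < r → r ≤ 2 * δ →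
      ¬ SameRay ℝ (halfEdge c m a b s) (-(c x + r • d)) := by
    intro a b s r hp hr hr'
    obtain ⟨⟨-, h2⟩, -, h4⟩ := hball (y := r) (by rw [Real.dist_0_eq_abs, abs_of_pos hr]; linarith)
    rcases hp.2.2.2 with rfl | ⟨hb, hab⟩
    · rw [hub]
      exact h4 a hp.1
    · exact h2 a hp.1 b hb hab s ⟨hp.2.1, hp.2.2.1⟩
  -- The segment has length parameter `2 * δ`: the half-edge of `x` covers `0` to `δ`, and the
  -- negated half-edge of `y` covers the rest from its far end.
  let c' : V → E := fun a => if a = y then -(c x + (2 * δ) • d) else c a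
  let m' : V → V → E := fun a b => if a = x ∧ b = y then c x + δ • d else
    if a = y then -(c x + δ • d) else m a b
  have cases_point : ∀ {a b s}, IsStarPoint G (insert y S) a b s →
      (IsStarPoint G S a b s ∧ halfEdge c' m' a b s = halfEdge c m a b s) ∨
      (a = x ∧ b = y ∧ 0 < s ∧ s ≤ 1 ∧ halfEdge c' m' a b s = c x + (s * δ) • d) ∨
      (a = y ∧ 0 ≤ s ∧ s ≤ 1 ∧ (s = 0 ∨ b = x) ∧
        halfEdge c' m' a b s = -(c x + ((2 - s) * δ) • d)) := by
    rintro a b s ⟨ha, h0, h1, hs⟩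
    rcases ha with rfl | ha
    · refine Or.inr (Or.inr ⟨rfl, h0, h1, hs.imp_right fun h => ?_, ?_⟩)
      · obtain ⟨hb, hab⟩ := h
        rcases hb with rfl | hb
        · exact absurd hab (G.loopless.irrefl _)
        · exact hxy b hb hab
      · simp only [halfEdge, c', m', if_true, if_neg (fun h : a = x ∧ b = a => hne h.1.symm)]
        module
    · have hay : a ≠ y := fun e => hy (e ▸ ha)
      rcases h0.eq_or_lt with rfl | h0
      · exact Or.inl ⟨hubPoint a b ha, by simp [halfEdge, c', hay]⟩
      · obtain ⟨hb, hab⟩ := hs.resolve_left h0.ne'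
        rcases hb with rfl | hb
        · obtain rfl := hxy a ha hab.symm
          refine Or.inr (Or.inl ⟨rfl, rfl, h0, h1, ?_⟩)
          simp only [halfEdge, c', m', if_neg hay, and_self, if_true]
          module
        · have hby : b ≠ y := fun e => hy (e ▸ hb)
          exact Or.inl ⟨⟨ha, h0.le, h1, Or.inr ⟨hb, hab⟩⟩, by simp [halfEdge, c', m', hay, hby]⟩
  have le1 : ∀ {s : ℝ}, 0 < s → s ≤ 1 → 0 < s * δ ∧ s * δ ≤ 2 * δ := fun h0 h1 =>
    ⟨by positivity, by nlinarith⟩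
  have le2 : ∀ {s : ℝ}, 0 ≤ s → s ≤ 1 → 0 < (2 - s) * δ ∧ (2 - s) * δ ≤ 2 * δ := fun h0 h1 =>
    ⟨mul_pos (by linarith) hδ, by nlinarith⟩
  refine ⟨c', m', ?_, ?_, ?_, ?_⟩
  · rintro a (rfl | ha) b (rfl | hb) hab
    · exact absurd hab (G.loopless.irrefl _)
    · obtain rfl := hxy b hb hab
      simp [m', hne.symm]
    · obtain rfl := hxy a ha hab.symm
      simp [m', hne.symm]
    · have hay : a ≠ y := fun e => hy (e ▸ ha)
      have hby : b ≠ y := fun e => hy (e ▸ hb)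
      simp [m', hay, hby, h.midpoint_symm a ha b hb hab]
  · intro a b s hp
    rcases cases_point hp with ⟨h1, h2⟩ | ⟨-, -, -, -, h2⟩ | ⟨-, -, -, -, h2⟩ <;> rw [h2]
    · exact h.ne_zero h1
    · exact hnz _
    · exact neg_ne_zero.2 (hnz _)
  · intro a b s a' b' s' hp hq hr
    rcases cases_point hp with ⟨h1, h2⟩ | ⟨rfl, rfl, h3, h4, h2⟩ | ⟨rfl, h3, h4, h5, h2⟩ <;>
      rcases cases_point hq with ⟨k1, k2⟩ | ⟨rfl, rfl, k3, k4, k2⟩ | ⟨rfl, k3, k4, k5, k2⟩ <;>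
      rw [h2, k2] at hr
    · exact h.eq_of_sameRay h1 k1 hr
    · exact absurd hr (far h1 (le1 k3 k4).1 (le1 k3 k4).2)
    · exact absurd hr (farNeg h1 (le2 k3 k4).1 (le2 k3 k4).2)
    · exact absurd hr.symm (far k1 (le1 h3 h4).1 (le1 h3 h4).2)
    · exact ⟨rfl, mul_right_cancel₀ hδ.ne' (eq_of_sameRay_add_smul hd' hcx hr), Or.inr rfl⟩
    · exact absurd hr (not_sameRay_neg_add_smul hd' hcx)
    · exact absurd hr.symm (farNeg k1 (le2 h3 h4).1 (le2 h3 h4).2)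
    · exact absurd hr.symm (not_sameRay_neg_add_smul hd' hcx)
    · have := mul_right_cancel₀ hδ.ne' (eq_of_sameRay_add_smul hd' hcx (sameRay_neg_iff.1 hr))
      have hs : s = s' := by linarith
      subst hs
      refine ⟨rfl, rfl, ?_⟩
      rcases h5 with h5 | h5
      · exact Or.inl h5
      · exact k5.imp_right fun k5 => h5.trans k5.symm
  · intro a b s a' b' s' hp hq hr
    rcases cases_point hp with ⟨h1, h2⟩ | ⟨rfl, rfl, h3, h4, h2⟩ | ⟨rfl, h3, h4, h5, h2⟩ <;>
      rcases cases_point hq with ⟨k1, k2⟩ | ⟨rfl, rfl, k3, k4, k2⟩ | ⟨rfl, k3, k4, k5, k2⟩ <;>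
      rw [h2, k2] at hr
    · exact h.eq_of_sameRay_neg h1 k1 hr
    · exact absurd hr (farNeg h1 (le1 k3 k4).1 (le1 k3 k4).2)
    · rw [neg_neg] at hr
      exact absurd hr (far h1 (le2 k3 k4).1 (le2 k3 k4).2)
    · have := sameRay_neg_iff.2 hr
      rw [neg_neg] at this
      exact absurd this.symm (farNeg k1 (le1 h3 h4).1 (le1 h3 h4).2)
    · exact absurd hr (not_sameRay_neg_add_smul hd' hcx)
    · rw [neg_neg] at hr
      have := mul_right_cancel₀ hδ.ne' (eq_of_sameRay_add_smul hd' hcx hr)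
      have hs' : s' = 1 := by linarith
      exact ⟨rfl, k5.resolve_left (by rw [hs']; exact one_ne_zero), by linarith, hs'⟩
    · exact absurd (sameRay_neg_iff.1 hr).symm (far k1 (le2 h3 h4).1 (le2 h3 h4).2)
    · have := mul_right_cancel₀ hδ.ne' (eq_of_sameRay_add_smul hd' hcx (sameRay_neg_iff.1 hr))
      have hs : s = 1 := by linarith
      exact ⟨(h5.resolve_left (by rw [hs]; exact one_ne_zero)).symm, rfl, hs, by linarith⟩
    · exact absurd (sameRay_neg_iff.1 hr).symm fun hr =>
        not_sameRay_neg_add_smul hd' hcx hr.symm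

end Extension

/-- The graph that joins the points at distance `D`. -/
def distanceGraph (X : Type*) [MetricSpace X] (D : ℝ) : SimpleGraph X where
  Adj x y := x ≠ y ∧ dist x y = D
  symm := ⟨fun _ _ h => ⟨h.1.symm, by rw [dist_comm]; exact h.2⟩⟩
  loopless := ⟨fun _ h => h.1 rfl⟩

/-! ### Metric geometry of the cones spanned by vectors of length `D`. -/

section Cone

variable {E : Type*} [NormedAddCommGroup E] [InnerProductSpace ℝ E] {D : ℝ}

open scoped RealInnerProductSpace

theorem inner_sub_sub_eq (x y z : E) :
    ⟪z - x, y - x⟫ = (‖z - x‖ ^ 2 + ‖y - x‖ ^ 2 - ‖z - y‖ ^ 2) / 2 := by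
  have := norm_sub_sq_real (z - x) (y - x)
  rw [sub_sub_sub_cancel_right] at this
  linarith

/-- The combination of the vectors from `x` to the points of `N` with weights `γ`. -/
def coneCombination (N : Finset E) (x : E) (γ : E → ℝ) : E := ∑ y ∈ N, γ y • (y - x)

theorem smul_coneCombination (N : Finset E) (x : E) (γ : E → ℝ) (a : ℝ) :
    a • coneCombination N x γ = coneCombination N x fun y => a * γ y := by
  simp only [coneCombination, Finset.smul_sum, smul_smul]

theorem coneCombination_hub [DecidableEq E] {N : Finset E} {x y : E} {t α : ℝ}
    (h : α = 0 ∨ y ∈ N) :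
    coneCombination N x (fun k => t + if k = y then α else 0) =
      t • ∑ k ∈ N, (k - x) + α • (y - x) := by
  simp only [coneCombination, add_smul, Finset.sum_add_distrib, Finset.smul_sum, ite_smul, zero_smul,
    Finset.sum_ite_eq']
  rcases h with rfl | h
  · simp
  · simp [h]

variable {N : Finset E} {x : E} {γ : E → ℝ} (hN : ∀ y ∈ N, dist x y = D) (hγ : ∀ y ∈ N, 0 ≤ γ y)
include hN hγ

/-- By the law of cosines each generator contributes at least `‖z - x‖ ^ 2 / 2` per unit weight,
because `‖z - y‖ ≤ D = ‖y - x‖`. -/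
theorem le_inner_coneCombination {z : E} (hz : ∀ y ∈ N, dist z y ≤ D) :
    ‖z - x‖ ^ 2 / 2 * ∑ y ∈ N, γ y ≤ ⟪z - x, coneCombination N x γ⟫ := by
  rw [coneCombination, inner_sum, Finset.mul_sum]
  refine Finset.sum_le_sum fun y hy => ?_
  rw [inner_smul_right, mul_comm]
  refine mul_le_mul_of_nonneg_left ?_ (hγ y hy)
  have h1 := hN y hy
  have h2 := hz y hy
  rw [dist_comm, dist_eq_norm] at h1
  rw [dist_eq_norm] at h2
  rw [inner_sub_sub_eq, h1]
  have := pow_le_pow_left₀ (norm_nonneg _) h2 2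
  linarith

theorem norm_coneCombination_le : ‖coneCombination N x γ‖ ≤ (∑ y ∈ N, γ y) * D := by
  rw [coneCombination, Finset.sum_mul]
  refine norm_sum_le_of_le _ fun y hy => ?_
  rw [norm_smul, Real.norm_of_nonneg (hγ y hy), ← dist_eq_norm, dist_comm, hN y hy]

theorem one_le_sum_of_norm_coneCombination_eq (hD : 0 < D) (h : ‖coneCombination N x γ‖ = D) :
    1 ≤ ∑ y ∈ N, γ y := by
  have := norm_coneCombination_le hN hγ
  rw [h] at this
  exact le_of_mul_le_mul_right (by linarith) hD

/-- A point within distance `D` of all points of `N` is within distance `D` of the points of the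
sphere about `x` in the cone generated by `N`. -/
theorem sq_norm_sub_le_of_norm_coneCombination_eq (hD : 0 < D) (h : ‖coneCombination N x γ‖ = D)
    {z : E} (hz : ∀ y ∈ N, dist z y ≤ D) :
    ‖z - x‖ ^ 2 ≤ 2 * ⟪z - x, coneCombination N x γ⟫ := by
  have h1 := le_inner_coneCombination hN hγ hz
  have h2 := one_le_sum_of_norm_coneCombination_eq hN hγ hD h
  nlinarith [sq_nonneg ‖z - x‖]

/-- The direction from `x` to a point `y` of `N` is extreme in the cone generated by `N` if `y` has
distance `D` from a point `z ≠ x` that is within distance `D` of all points of `N`. -/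
theorem eq_zero_of_coneCombination_eq {y z : E} (hy : y ∈ N) (hzx : z ≠ x)
    (hzy : dist z y = D) (hz : ∀ k ∈ N, dist z k ≤ D) (h : coneCombination N x γ = y - x) {k : E}
    (hk : k ∈ N) (hky : k ≠ y) : γ k = 0 := by
  have hyx : ‖y - x‖ = D := by rw [← dist_eq_norm, dist_comm, hN y hy]
  have h1 := le_inner_coneCombination hN hγ hz
  rw [h, inner_sub_sub_eq, hyx, ← dist_eq_norm z y, hzy] at h1
  have hpos : 0 < ‖z - x‖ ^ 2 := pow_pos (norm_pos_iff.2 (sub_ne_zero.2 hzx)) 2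
  -- Since `‖z - y‖ = ‖y - x‖`, the inner product of `z - x` and `y - x` is exactly `‖z - x‖ ^ 2 /
  -- 2`, which bounds the total weight.
  have hsum : ∑ k ∈ N, γ k ≤ 1 := by
    by_contra! hlt
    nlinarith
  have h2 : ⟪y - x, coneCombination N x γ⟫ = D ^ 2 := by
    rw [h, real_inner_self_eq_norm_sq, hyx]
  have h3 : ⟪y - x, coneCombination N x γ⟫ =
      D ^ 2 * ∑ k ∈ N, γ k - (∑ k ∈ N, γ k * ‖y - k‖ ^ 2) / 2 := by
    rw [coneCombination, inner_sum, Finset.mul_sum, Finset.sum_div, ← Finset.sum_sub_distrib]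
    refine Finset.sum_congr rfl fun k hk => ?_
    rw [inner_smul_right, inner_sub_sub_eq, hyx, ← dist_eq_norm k x, dist_comm, hN k hk]
    ring
  have h4 : ∀ k ∈ N, 0 ≤ γ k * ‖y - k‖ ^ 2 := fun k hk => mul_nonneg (hγ k hk) (sq_nonneg _)
  -- Total weight at most 1 leaves no room for this loss in the expansion of `‖y - x‖ ^ 2`.
  have h5 : ∑ k ∈ N, γ k * ‖y - k‖ ^ 2 = 0 :=
    le_antisymm (by nlinarith [sq_nonneg D]) (Finset.sum_nonneg h4)
  have h6 := (Finset.sum_eq_zero_iff_of_nonneg h4).1 h5 k hk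
  refine (mul_eq_zero.1 h6).resolve_right (pow_ne_zero 2 ?_)
  exact norm_ne_zero_iff.2 (sub_ne_zero.2 hky.symm)

/-- The cone at `x` meets the antipode of the cone at `y` at most in the direction of `y - x`. -/
theorem eq_sub_of_coneCombination_eq_neg (hD : 0 < D) {M : Finset E} {y : E} {γ' : E → ℝ}
    (hM : ∀ z ∈ M, dist y z = D) (hγ' : ∀ z ∈ M, 0 ≤ γ' z) (hNM : ∀ k ∈ N, ∀ z ∈ M, dist z k ≤ D)
    (hxy : dist x y ≤ D) (h : ‖coneCombination N x γ‖ = D)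
    (heq : coneCombination M y γ' = -coneCombination N x γ) :
    coneCombination N x γ = y - x := by
  set p := coneCombination N x γ with hp
  have hq : ‖coneCombination M y γ'‖ = D := by rw [heq, norm_neg, h]
  -- So `x + p` itself qualifies as a test point for the cone at `y`. That second application bounds
  -- `‖p - (y - x)‖ ^ 2` by its own negative.
  have h1 : ∀ z ∈ M, dist (x + p) z ≤ D := by
    intro z hz
    have h2 := sq_norm_sub_le_of_norm_coneCombination_eq hN hγ hD h fun k hk => hNM k hk z hz
    have h3 := norm_sub_sq_real (z - x) p
    rw [h] at h3
    rw [dist_comm, dist_eq_norm, ← sub_sub]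
    exact le_of_sq_le_sq (by linarith) hD.le
  have h2 := sq_norm_sub_le_of_norm_coneCombination_eq hM hγ' hD hq h1
  have e : x + p - y = p - (y - x) := by abel
  rw [dist_comm, dist_eq_norm] at hxy
  rw [heq, e, inner_neg_right, inner_sub_left, real_inner_self_eq_norm_sq, h] at h2
  have h3 := norm_sub_sq_real p (y - x)
  rw [h, real_inner_comm] at h3
  have h4 := pow_le_pow_left₀ (norm_nonneg _) hxy 2
  have h5 : ‖p - (y - x)‖ ^ 2 ≤ 0 := by linarith
  have h6 : ‖p - (y - x)‖ = 0 := by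
    have := sq_nonneg ‖p - (y - x)‖
    exact pow_eq_zero_iff two_ne_zero |>.1 (le_antisymm h5 this)
  exact sub_eq_zero.1 (norm_eq_zero.1 h6)

end Cone

/-! ### Star systems of distance graphs. -/

section Core

variable {E : Type*} [NormedAddCommGroup E] [InnerProductSpace ℝ E] {D : ℝ} {S : Finset E}

open scoped RealInnerProductSpace

/-- At least two neighbours are needed twice: a second neighbour of `y` makes `y - x` extreme in the
cone at `x`, and a second neighbour of `x` keeps the hub off that extreme ray. -/
theorem isStarSystem_distanceGraph [DecidableEq E] (hS : ∀ x ∈ S, ∀ y ∈ S, dist x y ≤ D)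
    (hdeg : ∀ x ∈ S, ∀ k, ∃ z ∈ S, (distanceGraph E D).Adj x z ∧ z ≠ k) :
    IsStarSystem (distanceGraph E D) S (fun x => ∑ k ∈ S with (dist x k = D), (k - x))
      (fun x y => y - x) := by
  rcases S.eq_empty_or_nonempty with rfl | ⟨x₀, hx₀⟩
  · simpa using isStarSystem_empty _ _
  have hD : 0 < D := by
    obtain ⟨z, -, hz, -⟩ := hdeg x₀ hx₀ x₀
    rw [← hz.2]
    exact dist_pos.2 hz.1
  clear x₀ hx₀
  set N : E → Finset E := fun x => S.filter (fun k => dist x k = D) with hNdef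
  have memN : ∀ {x y}, y ∈ N x ↔ y ∈ S ∧ dist x y = D := fun {x y} => Finset.mem_filter
  have adjN : ∀ {x y}, y ∈ S → (distanceGraph E D).Adj x y → y ∈ N x :=
    fun hy h => memN.2 ⟨hy, h.2⟩
  have neN : ∀ {x y}, y ∈ N x → y ≠ x := by
    rintro x y hy rfl
    have := (memN.1 hy).2
    rw [dist_self] at this
    exact hD.ne this
  have hN : ∀ x, ∀ y ∈ N x, dist x y = D := fun x y hy => (memN.1 hy).2
  have hdegN : ∀ x ∈ S, ∀ k, ∃ z ∈ N x, z ≠ k := fun x hx k => by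
    obtain ⟨z, hz, hxz, hzk⟩ := hdeg x hx k
    exact ⟨z, adjN hz hxz, hzk⟩
  set c : E → E := fun x => ∑ k ∈ N x, (k - x) with hc
  set m : E → E → E := fun x y => y - x with hm
  have hle : ∀ {x z}, z ∈ S → ∀ k ∈ N x, dist z k ≤ D :=
    fun hz k hk => hS _ hz k (memN.1 hk).1
  -- Cone weights of a star point: the hub gives `1 - s` to every neighbour, the tip adds `s` at
  -- `y`.
  let W : E → ℝ → E → ℝ := fun y s k => (1 - s) + if k = y then s else 0
  have hW : ∀ {x y s}, IsStarPoint (distanceGraph E D) S x y s →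
      halfEdge c m x y s = coneCombination (N x) x (W y s) ∧ ∀ k, 0 ≤ W y s k := by
    rintro x y s ⟨hx, h0, h1, h2⟩
    refine ⟨?_, fun k => ?_⟩
    · rw [coneCombination_hub (h2.imp_right fun h => adjN h.1 h.2)]
      rfl
    · exact add_nonneg (by linarith) (by split_ifs <;> linarith)
  have hpos : ∀ {x y s}, IsStarPoint (distanceGraph E D) S x y s → ∀ z ∈ S, z ≠ x →
      0 < ⟪z - x, halfEdge c m x y s⟫ := by
    intro x y s hp z hz hzx
    have h2 := hp.2.2.2
    rw [(hW hp).1]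
    refine lt_of_lt_of_le (mul_pos ?_ ?_)
      (le_inner_coneCombination (hN x) (fun k _ => (hW hp).2 k) (hle hz))
    · have := norm_pos_iff.2 (sub_ne_zero.2 hzx)
      positivity
    · refine Finset.sum_pos' (fun k _ => (hW hp).2 k) ?_
      rcases h2 with rfl | ⟨hy, hxy⟩
      · obtain ⟨k, hk, -⟩ := hdegN x hp.1 x
        exact ⟨k, hk, by simp [W]⟩
      · exact ⟨y, adjN hy hxy, by simp [W]⟩
  have hub : ∀ x, halfEdge c m x x 0 = c x := fun x => by simp [halfEdge]
  have tip : ∀ x y, halfEdge c m x y 1 = y - x := fun x y => by simp [halfEdge, m]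
  have extreme : ∀ {x y}, x ∈ S → y ∈ N x → ∀ γ : E → ℝ, (∀ k ∈ N x, 0 ≤ γ k) →
      coneCombination (N x) x γ = y - x → ∀ k ∈ N x, k ≠ y → γ k = 0 := by
    intro x y hx hy γ hγ h k hk hky
    obtain ⟨z, hz, hzx⟩ := hdegN y (memN.1 hy).1 x
    exact eq_zero_of_coneCombination_eq (hN x) hγ hy hzx (by rw [dist_comm, hN y z hz])
      (hle (memN.1 hz).1) h hk hky
  have spread : ∀ {x y y' : E} {t α β : ℝ}, x ∈ S → 0 ≤ t → 0 ≤ α → 0 ≤ β → (α = 0 ∨ y ∈ N x) →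
      (β = 0 ∨ y' ∈ N x) → t • c x + α • (y - x) = β • (y' - x) →
      t = 0 ∧ α = β ∧ (α = 0 ∨ y = y') := by
    intro x y y' t α β hx ht hα hβ hy hy' h
    rcases hβ.eq_or_lt with rfl | hβ
    · obtain ⟨z, hz, -⟩ := hdegN x hx x
      have h1 := hpos (y := x) (s := 0) ⟨hx, le_rfl, zero_le_one, Or.inl rfl⟩ z (memN.1 hz).1
        (neN hz)
      rw [hub] at h1
      have h2 := congrArg (fun v => ⟪z - x, v⟫) h
      simp only [inner_add_right, inner_smul_right, zero_mul] at h2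
      have h3 : 0 ≤ α * ⟪z - x, y - x⟫ := by
        rcases hy with rfl | hy
        · simp
        · have := hpos (y := y) (s := 1) ⟨hx, zero_le_one, le_rfl,
            Or.inr ⟨(memN.1 hy).1, (neN hy).symm, (memN.1 hy).2⟩⟩ z (memN.1 hz).1 (neN hz)
          rw [tip] at this
          positivity
      have ht0 : t = 0 := by
        by_contra hne
        have : 0 < t * ⟪z - x, c x⟫ := mul_pos (ht.lt_of_ne' hne) h1
        linarith
      subst ht0
      rw [zero_smul, zero_smul, zero_add, smul_eq_zero] at h
      have hα0 : α = 0 := by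
        rcases hy with hy | hy
        · exact hy
        · exact h.resolve_right (sub_ne_zero.2 (neN hy))
      exact ⟨rfl, hα0, Or.inl hα0⟩
    · have hy' := hy'.resolve_left hβ.ne'
      have h1 := extreme hx hy' (fun k => β⁻¹ * (t + if k = y then α else 0))
        (fun k _ => mul_nonneg (inv_nonneg.2 hβ.le)
          (add_nonneg ht (by split_ifs <;> linarith)))
        (by rw [← smul_coneCombination, coneCombination_hub hy, h, inv_smul_smul₀ hβ.ne'])
      have h2 : ∀ k ∈ N x, k ≠ y' → t + (if k = y then α else 0) = 0 := fun k hk hky =>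
        (mul_eq_zero.1 (h1 k hk hky)).resolve_left (inv_ne_zero hβ.ne')
      have ht0 : t = 0 := by
        -- A neighbour other than `y'` has weight `t` or `t + α`; extremeness makes it zero, and
        -- both terms are nonnegative.
        obtain ⟨k, hk, hky⟩ := hdegN x hx y'
        have h3 := h2 k hk hky
        split_ifs at h3 <;> linarith
      subst ht0
      rcases hy with rfl | hy
      · rw [zero_smul, zero_smul, zero_add, eq_comm, smul_eq_zero] at h
        exact absurd h (not_or.2 ⟨hβ.ne', sub_ne_zero.2 (neN hy')⟩)
      · rcases eq_or_ne y y' with rfl | hyy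
        · refine ⟨rfl, ?_, Or.inr rfl⟩
          rw [zero_smul, zero_add] at h
          exact smul_left_injective ℝ (sub_ne_zero.2 (neN hy)) h
        · have h3 := h2 y hy hyy
          rw [if_pos rfl, zero_add] at h3
          subst h3
          rw [zero_smul, zero_smul, zero_add, eq_comm, smul_eq_zero] at h
          exact absurd h (not_or.2 ⟨hβ.ne', sub_ne_zero.2 (neN hy')⟩)
  have hne : ∀ {x y s}, IsStarPoint (distanceGraph E D) S x y s → halfEdge c m x y s ≠ 0 := by
    intro x y s hp h0
    obtain ⟨z, hz, -⟩ := hdegN x hp.1 x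
    have := hpos hp z (memN.1 hz).1 (neN hz)
    rw [h0, inner_zero_right] at this
    exact this.false
  have peak : ∀ {x y y' s}, IsStarPoint (distanceGraph E D) S x y' s →
      (∀ k ∈ N x, k ≠ y → W y' s k = 0) → y = y' ∧ s = 1 := by
    rintro x y y' s ⟨hx, h0, h1, h2⟩ h
    have hs : s = 1 := by
      obtain ⟨k, hk, hky⟩ := hdegN x hx y
      have h3 := h k hk hky
      simp only [W] at h3
      split_ifs at h3 <;> linarith
    subst hs
    refine ⟨?_, rfl⟩
    by_contra hyy
    obtain ⟨hy', hadj⟩ := h2.resolve_left one_ne_zero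
    have := h y' (adjN hy' hadj) (Ne.symm hyy)
    simp [W] at this
  refine ⟨fun x _ y _ _ => (neg_sub _ _).symm, hne, ?_, ?_⟩
  · intro x y s x' y' s' hp hq hr
    obtain ⟨a, b, ha, hb, hab⟩ := hr.exists_pos (hne hp) (hne hq)
    have hxx : x = x' := by
      by_contra hxx
      have h1 := mul_pos ha (hpos hp x' hq.1 (Ne.symm hxx))
      have h2 := mul_pos hb (hpos hq x hp.1 hxx)
      rw [← inner_smul_right, hab, ← neg_sub, inner_neg_left] at h1
      rw [← inner_smul_right] at h2
      linarith
    subst hxx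
    refine ⟨rfl, ?_⟩
    have hy : ∀ {a y s}, IsStarPoint (distanceGraph E D) S x y s → a * s = 0 ∨ y ∈ N x :=
      fun hp => hp.2.2.2.imp (fun h => by rw [h, mul_zero]) fun h => adjN h.1 h.2
    simp only [halfEdge, m, smul_add, smul_smul] at hab
    -- Cancelling the smaller hub coefficient leaves a pure tip vector on one side, as `spread`
    -- requires.
    rcases le_total (b * (1 - s')) (a * (1 - s)) with ht | ht
    · obtain ⟨h1, h2, h3⟩ := spread (t := a * (1 - s) - b * (1 - s')) (α := a * s) (β := b * s')
        (y := y) (y' := y') hp.1 (by linarith) (mul_nonneg ha.le hp.2.1)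
        (mul_nonneg hb.le hq.2.1) (hy hp) (hy hq)
        (by rw [sub_smul, sub_add_eq_add_sub, hab, add_sub_cancel_left])
      have : a = b := by linarith
      subst this
      exact ⟨mul_left_cancel₀ ha.ne' h2,
        h3.imp_left fun h => (mul_eq_zero.1 h).resolve_left ha.ne'⟩
    · obtain ⟨h1, h2, h3⟩ := spread (t := b * (1 - s') - a * (1 - s)) (α := b * s') (β := a * s)
        (y := y') (y' := y) hp.1 (by linarith) (mul_nonneg hb.le hq.2.1)
        (mul_nonneg ha.le hp.2.1) (hy hq) (hy hp)
        (by rw [sub_smul, sub_add_eq_add_sub, ← hab, add_sub_cancel_left])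
      have : a = b := by linarith
      subst this
      have hss := mul_left_cancel₀ ha.ne' h2
      exact ⟨hss.symm, h3.imp (fun h => hss ▸ (mul_eq_zero.1 h).resolve_left ha.ne') Eq.symm⟩
  · intro x y s x' y' s' hp hq hr
    obtain ⟨a, b, ha, hb, hab⟩ := hr.exists_pos (hne hp) (neg_ne_zero.2 (hne hq))
    have hxx : x ≠ x' := by
      rintro rfl
      obtain ⟨z, hz, -⟩ := hdegN x hp.1 x
      have h1 := mul_pos ha (hpos hp z (memN.1 hz).1 (neN hz))
      have h2 := mul_pos hb (hpos hq z (memN.1 hz).1 (neN hz))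
      rw [← inner_smul_right, hab, smul_neg, inner_neg_right, inner_smul_right] at h1
      linarith
    have hnorm := norm_pos_iff.2 (hne hp)
    -- Rescales the common vector to length `D`, the radius at which the ball argument applies.
    set A := D / ‖halfEdge c m x y s‖ with hA
    have hApos : 0 < A := div_pos hD hnorm
    have hp1 : A • halfEdge c m x y s = coneCombination (N x) x fun k => A * W y s k := by
      rw [(hW hp).1, smul_coneCombination]
    have hq1 : (A / a * b) • halfEdge c m x' y' s' =
        coneCombination (N x') x' fun k => A / a * b * W y' s' k := by
      rw [(hW hq).1, smul_coneCombination]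
    have hpq : (A / a * b) • halfEdge c m x' y' s' = -(A • halfEdge c m x y s) := by
      rw [← smul_smul, eq_neg_iff_add_eq_zero, ← neg_eq_zero, neg_add, ← smul_neg, ← smul_neg,
        ← hab, smul_smul, div_mul_cancel₀ _ ha.ne', add_neg_cancel]
    have hAD : ‖A • halfEdge c m x y s‖ = D := by
      rw [norm_smul, Real.norm_of_nonneg hApos.le, hA, div_mul_cancel₀ _ hnorm.ne']
    have hBpos : 0 < A / a * b := by positivity
    rw [hp1] at hAD hpq
    rw [hq1] at hpq
    have hγ : ∀ k ∈ N x, 0 ≤ A * W y s k := fun k _ => mul_nonneg hApos.le ((hW hp).2 k)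
    have hγ' : ∀ k ∈ N x', 0 ≤ A / a * b * W y' s' k :=
      fun k _ => mul_nonneg hBpos.le ((hW hq).2 k)
    have key := eq_sub_of_coneCombination_eq_neg (hN x) hγ hD (hN x') hγ'
      (fun k hk z hz => hS z (memN.1 hz).1 k (memN.1 hk).1) (hS x hp.1 x' hq.1) hAD hpq
    have hdist : dist x x' = D := by rw [dist_comm, dist_eq_norm, ← key, hAD]
    obtain ⟨h1, h2⟩ := peak (y := x') hp fun k hk hkx =>
      (mul_eq_zero.1 (extreme hp.1 (memN.2 ⟨hq.1, hdist⟩) _ hγ key k hk hkx)).resolve_left hApos.ne'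
    obtain ⟨h3, h4⟩ := peak (y := x) hq fun k hk hkx =>
      (mul_eq_zero.1 (extreme hq.1 (memN.2 ⟨hp.1, by rw [dist_comm, hdist]⟩) _ hγ'
        (by rw [hpq, key, neg_sub]) k hk hkx)).resolve_left hBpos.ne'
    exact ⟨h1, h3.symm, h2, h4⟩

/-- `D` is only an upper bound for the distances, so the hypothesis survives deleting a point even
if the diameter drops. -/
theorem exists_isStarSystem_distanceGraph [FiniteDimensional ℝ E] (hE : 2 < Module.finrank ℝ E)
    (S : Finset E) (hS : ∀ x ∈ S, ∀ y ∈ S, dist x y ≤ D) :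
    ∃ c m, IsStarSystem (E := E) (distanceGraph E D) S c m := by
  classical
  induction S using Finset.strongInduction with
  | H S ih =>
    by_cases hdeg : ∀ x ∈ S, ∀ k, ∃ z ∈ S, (distanceGraph E D).Adj x z ∧ z ≠ k
    · exact ⟨_, _, isStarSystem_distanceGraph hS hdeg⟩
    push Not at hdeg
    obtain ⟨y, hy, k, hk⟩ := hdeg
    have hins : (S : Set E) = insert y (S.erase y : Set E) := by
      rw [← Finset.coe_insert, Finset.insert_erase hy]
    rw [hins]
    rcases (S.erase y).eq_empty_or_nonempty with he | ⟨w, hw⟩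
    · have : Nontrivial E := Module.nontrivial_of_finrank_pos (R := ℝ) (by omega)
      obtain ⟨e, he0⟩ := exists_ne (0 : E)
      rw [he]
      exact ⟨fun _ => e, fun _ _ => e, by simpa using isStarSystem_singleton y he0 _⟩
    · obtain ⟨c, m, h⟩ := ih (S.erase y) (Finset.erase_ssubset hy) fun a ha b hb =>
        hS a (Finset.mem_of_mem_erase ha) b (Finset.mem_of_mem_erase hb)
      have hk' : ∀ z ∈ S.erase y, (distanceGraph E D).Adj y z → z = k :=
        fun z hz => hk z (Finset.mem_of_mem_erase hz)
      by_cases hkS : k ∈ S.erase y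
      · exact h.exists_insert hE (Finset.finite_toSet _) hkS (by simp) hk'
      -- Here `y` is isolated, and the arbitrary remaining point `w` serves as anchor.
      · exact h.exists_insert hE (Finset.finite_toSet _) hw (by simp) fun z hz hyz =>
          absurd (hk' z hz hyz ▸ hz) hkS

end Core

theorem mainTheorem3 (S : Set (EuclideanSpace ℝ (Fin 3))) (hS : S.Finite) :
    ∃ (D : GraphEmbedding (diameterGraph S).bipartiteDoubleCover UnitSphere)
      (E : GraphEmbedding (diameterGraph S) ProjectivePlane),
      D.IsCentrallySymmetric ∧ E.IsAntipodalQuotient D ∧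
      ∀ (u : S) (c : (diameterGraph S).Walk u u),
        c.IsCycle → Odd c.length → ¬ (E.walkPath c).IsContractible := by
  obtain ⟨c, m, h⟩ := exists_isStarSystem_distanceGraph (D := Metric.diam S) (by simp) hS.toFinset
    fun x hx y hy => Metric.dist_le_diam_of_mem hS.isBounded (by simpa using hx) (by simpa using hy)
  have h' := h.comap (H := diameterGraph S) Subtype.val Subtype.val_injective (by simp)
    fun v w hvw => ⟨Subtype.coe_ne_coe.2 hvw.1, hvw.2⟩
  exact ⟨h'.drawing, h'.drawing.antipodalQuotient h'.drawing_isCentrallySymmetric,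
    h'.drawing_isCentrallySymmetric,
    h'.drawing.antipodalQuotient_isAntipodalQuotient h'.drawing_isCentrallySymmetric,
    fun u p _ hp => GraphEmbedding.not_isContractible_walkPath_antipodalQuotient _ _ p hp⟩
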